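/- Let $K:[0,1]\times[0,1]\to\mathbb{R}$ be given by $K(x,y)=\frac12-\{1/(xy)\}$ if $0<x,y\le 1$ (where $\{\alpha\}=\alpha-\lfloor\alpha\rfloor$) and $K(x,y)=0$ if $xy=0$, and let $$K_2(x,y)=\int_0^1 K(x,z)K(z,y)\,dz\qquad(0\le x,y\le 1).$$ A real-valued $\phi\in L^2([0,1])$ (a function, not a class of functions) with $\int_0^1\phi^2>0$ is called an eigenfunction of $K$ with eigenvalue $\lambda\in\mathbb{R}$ if $\phi(x)=\lambda\int_0^1K(x,y)\phi(y)\,dy$ for every $x\in[0,1]$. Let $\phi_1,\phi_2,\phi_3,\ldots$ be a maximal orthonormal system of eigenfunctions of $K$ (orthonormal for $\langle f,g\rangle=\int_0^1 f(x)g(x)\,dx$, and such that no eigenfunction of $K$ is orthogonal to every $\phi_j$), with corresponding non-zero eigenvalues $\lambda_1,\lambda_2,\lambda_3,\ldots$, numbered so that $|\lambda_j|\le|\lambda_{j+1}|$ for all $j$, and $\lambda_j\ge\lambda_{j+1}$ whenever $|\lambda_j|=|\lambda_{j+1}|$. **Theorem 2.11.** For all $x,y\in[0,1]$ the series $$\sum_{j=1}^{\infty}\frac{\phi_j(x)\phi_j(y)}{\lambda_j^2}$$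 converges absolutely, and its sum is $K_2(x,y)$. Moreover, for each $\varepsilon>0$, the series converges uniformly for $(x,y)\in[0,1]^2\setminus(0,\varepsilon)^2$. -/

import Mathlib

noncomputable section

namespace FloorKernel

open MeasureTheory

/-- The kernel `K(x,y) = 1/2 - {1/(xy)}` for `0 < x, y ≤ 1`, and `K(x,y) = 0` if `xy = 0`. -/
def K (x y : unitInterval) : ℝ :=
  if (x : ℝ) * (y : ℝ) = 0 then 0 else 1 / 2 - Int.fract ((x : ℝ) * (y : ℝ))⁻¹

/-- The iterated kernel `K₂(x,y) = ∫₀¹ K(x,z) K(z,y) dz`. -/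
def K₂ (x y : unitInterval) : ℝ :=
  ∫ z, K x z * K z y

/-- The (semi-definite) inner product `⟨f,g⟩ = ∫₀¹ f(x) g(x) dx` of square-integrable functions. -/
def innerL2 (f g : unitInterval → ℝ) : ℝ :=
  ∫ x, f x * g x

/-- `φ` is an eigenfunction of `K` with eigenvalue `μ`: it is Lebesgue measurable and
square-integrable, it has positive norm, and `φ(x) = μ ∫₀¹ K(x,y) φ(y) dy` holds for every
`x ∈ [0,1]` (not just almost everywhere). -/
structure IsEigenfunction (μ : ℝ) (φ : unitInterval → ℝ) : Prop where
  memLp : MemLp φ 2 volume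
  norm_pos : 0 < innerL2 φ φ
  eq_integral : ∀ x, φ x = μ * ∫ y, K x y * φ y

/-- `φ 0, φ 1, φ 2, …` is a maximal orthonormal system of eigenfunctions of `K`, with associated
eigenvalues `ev 0, ev 1, ev 2, …`, numbered by increasing absolute value, a positive eigenvalue
preceding a negative one of the same absolute value. -/
structure IsMaximalEigensystem (ev : ℕ → ℝ) (φ : ℕ → unitInterval → ℝ) : Prop where
  isEigenfunction : ∀ j, IsEigenfunction (ev j) (φ j)
  orthonormal : ∀ i j, innerL2 (φ i) (φ j) = if i = j then 1 else 0
  /-- The system cannot be enlarged: no eigenfunction is orthogonal to all its members. -/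
  maximal : ∀ (μ : ℝ) (ψ : unitInterval → ℝ), IsEigenfunction μ ψ → ∃ j, innerL2 ψ (φ j) ≠ 0
  ev_ne_zero : ∀ j, ev j ≠ 0
  abs_ev_le : ∀ j, |ev j| ≤ |ev (j + 1)|
  ev_le_of_abs_eq : ∀ j, |ev j| = |ev (j + 1)| → ev (j + 1) ≤ ev j

end FloorKernel

end

/-!
Write `k_x = K(x,·)`, a vector of norm at most `1/2` in `L²([0,1])`. The eigenfunction equation says
`φ_j(x)/λ_j = ⟪k_x, φ_j⟫`, and `K₂(x,y) = ⟪k_x, k_y⟫` since `K` is symmetric. So the claimed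
expansion is Parseval's identity for `k_x` and `k_y` with respect to the orthonormal family `φ_j`,
and it holds as soon as every `k_x` lies in the closed span of this family
(`IsMaximalEigensystem.kernelVec_mem`).

For that, let `g` be orthogonal to every `φ_j`. The integral operator with kernel `K` is symmetric,
and compact (`isCompactOperator_kernelOp`), so by maximality of the system and the spectral theorem
it kills `g` (`apply_eq_zero_of_maximal_eigenvectors`), which means that `⟪k_x, g⟫ = 0` for almost
every `x`. But `x ↦ k_x` is continuous away from `x = 0` (`continuousOn_kernelVec`) and `k_0 = 0`,
so `⟪k_x, g⟫ = 0` for every `x`, that is, every `k_x` is orthogonal to every such `g`.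

For the uniform convergence, the remainder after `n` terms is at most the distance of `k_x` from the
span of `φ_1, …, φ_n`. These distances decrease to `0`, are continuous on `[ε,1]`, and vanish for
`x = 0`; hence they tend to `0` uniformly on `{0} ∪ [ε,1]` by Dini's theorem. The roles of `x` and
`y` may be exchanged, and outside `(0,ε)²` at least one of them lies in `{0} ∪ [ε,1]`.
-/

noncomputable section

namespace FloorKernel

open MeasureTheory Filter Topology Module End

/-! ### Hilbert space facts -/

section Abstract

variable {E : Type*} [NormedAddCommGroup E] [InnerProductSpace ℝ E]

theorem mem_orthogonal_span_range {ι : Type*} {e : ι → E} {v : E} :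
    v ∈ (Submodule.span ℝ (Set.range e))ᗮ ↔ ∀ j, inner ℝ v (e j) = 0 := by
  refine ⟨fun hv j => (Submodule.mem_orthogonal' _ _).1 hv _ (Submodule.subset_span ⟨j, rfl⟩),
    fun hv => (Submodule.mem_orthogonal' _ _).2 fun u hu => ?_⟩
  have : Submodule.span ℝ (Set.range e) ≤ (ℝ ∙ v)ᗮ := by
    rw [Submodule.span_le]
    rintro _ ⟨j, rfl⟩
    exact Submodule.mem_orthogonal_singleton_iff_inner_right.2 (hv j)
  exact Submodule.mem_orthogonal_singleton_iff_inner_right.1 (this hu)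

/-- The remainder of the Parseval series of `inner v w` is at most `‖w‖` times the norm of the
component of `v` orthogonal to the first `n` members of the orthonormal sequence. -/
theorem abs_inner_sub_sum_le {e : ℕ → E} (he : Orthonormal ℝ e) (v w : E) (n : ℕ) :
    |inner ℝ v w - ∑ j ∈ Finset.range n, inner ℝ v (e j) * inner ℝ w (e j)| ≤
      √(‖v‖ ^ 2 - ∑ j ∈ Finset.range n, inner ℝ v (e j) ^ 2) * ‖w‖ := by
  set r : E := v - ∑ j ∈ Finset.range n, inner ℝ v (e j) • e j with hr
  have hrw (w : E) : inner ℝ r w =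
      inner ℝ v w - ∑ j ∈ Finset.range n, inner ℝ v (e j) * inner ℝ w (e j) := by
    simp only [hr, inner_sub_left, sum_inner, inner_smul_left, real_inner_comm _ w]
    simp
  have hre : ∀ i ∈ Finset.range n, inner ℝ r (e i) = 0 := fun i hi => by
    rw [hrw]
    simp only [orthonormal_iff_ite.1 he]
    simp [Finset.mem_range.1 hi]
  have hrr : ‖r‖ ^ 2 = ‖v‖ ^ 2 - ∑ j ∈ Finset.range n, inner ℝ v (e j) ^ 2 := by
    have h1 : inner ℝ r r = inner ℝ r v := by
      conv_lhs => rw [hr, ← hr, inner_sub_right, inner_sum]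
      rw [Finset.sum_eq_zero fun i hi => by rw [inner_smul_right, hre i hi, mul_zero], sub_zero]
    rw [← real_inner_self_eq_norm_sq, h1, hrw, real_inner_self_eq_norm_sq]
    simp only [pow_two]
  rw [← hrr, Real.sqrt_sq (norm_nonneg _), ← hrw]
  exact abs_real_inner_le_norm r w

variable [CompleteSpace E]

/-- If a family of eigenvectors of a compact symmetric operator `T` cannot be enlarged by an
eigenvector for a non-zero eigenvalue orthogonal to it, then `T` vanishes on its orthogonal
complement: the complement is invariant, and `T` has no non-zero eigenvalue there. -/
theorem apply_eq_zero_of_maximal_eigenvectors {ι : Type*} {T : E →L[ℝ] E}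
    (hT : IsCompactOperator T) (hsymm : T.IsSymmetric) {e : ι → E} {c : ι → ℝ}
    (he : ∀ j, T (e j) = c j • e j)
    (hmax : ∀ (α : ℝ) (v : E), α ≠ 0 → v ≠ 0 → T v = α • v → ∃ j, inner ℝ v (e j) ≠ 0)
    {g : E} (hg : ∀ j, inner ℝ g (e j) = 0) : T g = 0 := by
  let M : Submodule ℝ E := (Submodule.span ℝ (Set.range e))ᗮ
  have hM (v : E) : v ∈ M ↔ ∀ j, inner ℝ v (e j) = 0 := mem_orthogonal_span_range
  have hinv : ∀ v ∈ M, T v ∈ M := fun v hv => (hM _).2 fun j => by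
    rw [show inner ℝ (T v) (e j) = inner ℝ v (T (e j)) from hsymm v (e j), he, inner_smul_right,
      (hM v).1 hv j, mul_zero]
  have hS : T.restrict hinv = 0 := by
    refine (ContinuousLinearMap.eq_zero_of_forall_hasEigenvalue_eq_zero
      (hT.restrict' hinv) (hsymm.restrict_invariant hinv)).1 fun α hα => ?_
    by_contra hα0
    obtain ⟨v, hv, hv0⟩ := hα.exists_hasEigenvector
    obtain ⟨j, hj⟩ := hmax α (v : E) hα0 (by simpa using hv0)
      (congrArg Subtype.val (mem_eigenspace_iff.1 hv))
    exact hj ((hM _).1 v.2 j)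
  simpa using congrArg Subtype.val (DFunLike.congr_fun hS (⟨g, (hM g).2 hg⟩ : M))

/-- Parseval's identity for an orthonormal family that need not be complete, for vectors in the
double orthogonal complement of the family. -/
theorem hasSum_inner_mul_inner_of_orthonormal {ι : Type*} {e : ι → E} (he : Orthonormal ℝ e)
    {v w : E} (hv : v ∈ (Submodule.span ℝ (Set.range e))ᗮᗮ)
    (hw : w ∈ (Submodule.span ℝ (Set.range e))ᗮᗮ) :
    HasSum (fun j => inner ℝ v (e j) * inner ℝ w (e j)) (inner ℝ v w) := by
  let M : Submodule ℝ E := (Submodule.span ℝ (Set.range e))ᗮᗮ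
  let e' : ι → M := fun j => ⟨e j, Submodule.le_orthogonal_orthogonal _
    (Submodule.subset_span ⟨j, rfl⟩)⟩
  have he' : Orthonormal ℝ e' := ⟨he.1, fun _ _ h => he.2 h⟩
  have hbot : (Submodule.span ℝ (Set.range e'))ᗮ = ⊥ := by
    rw [Submodule.eq_bot_iff]
    intro m hm
    have hm' : (m : E) ∈ (Submodule.span ℝ (Set.range e))ᗮ :=
      mem_orthogonal_span_range.2 fun j => mem_orthogonal_span_range.1 hm j
    exact Subtype.ext (inner_self_eq_zero (𝕜 := ℝ).1 (m.2 m hm'))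
  have := (HilbertBasis.mkOfOrthogonalEqBot he' hbot).hasSum_inner_mul_inner ⟨v, hv⟩ ⟨w, hw⟩
  simp only [HilbertBasis.coe_mkOfOrthogonalEqBot, Submodule.coe_inner, e'] at this
  simpa only [real_inner_comm w] using this

end Abstract

/-! ### The kernel -/

theorem K_comm (x y : unitInterval) : K x y = K y x := by
  simp only [K, mul_comm]

theorem abs_K_le (x y : unitInterval) : |K x y| ≤ 1 / 2 := by
  unfold K
  split_ifs
  · norm_num
  · rw [abs_le]
    constructor <;>
      linarith [Int.fract_nonneg ((x : ℝ) * y)⁻¹, (Int.fract_lt_one ((x : ℝ) * y)⁻¹).le]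

theorem measurable_uncurry_K : Measurable fun p : unitInterval × unitInterval => K p.1 p.2 := by
  unfold K
  have h : Measurable fun p : unitInterval × unitInterval => (p.1 : ℝ) * (p.2 : ℝ) := by fun_prop
  exact Measurable.ite (h (measurableSet_singleton 0)) measurable_const
    (measurable_const.sub (measurable_fract.comp h.inv))

theorem measurable_K (x : unitInterval) : Measurable (K x) :=
  measurable_uncurry_K.comp (measurable_const.prodMk measurable_id)

theorem memLp_K (x : unitInterval) : MemLp (K x) 2 volume :=
  MemLp.of_bound (measurable_K x).aestronglyMeasurable (1 / 2)
    (ae_of_all _ fun y => abs_K_le x y)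

/-- For `x ≠ 0` the kernel is continuous in its first variable at `x`, for almost every value `z`
of the second: the exceptions are the countably many `z` with `1/(xz)` an integer. -/
theorem ae_tendsto_K {x : unitInterval} (hx : x ≠ 0) :
    ∀ᵐ z : unitInterval, Tendsto (fun y => K y z) (𝓝 x) (𝓝 (K x z)) := by
  have hx' : (x : ℝ) ≠ 0 := fun h => hx (Subtype.ext h)
  have hc : ((fun z : unitInterval => ((x : ℝ) * z)⁻¹) ⁻¹' Set.range ((↑) : ℤ → ℝ)).Countable := by
    refine (Set.countable_range _).preimage_of_injOn fun z _ w _ h => ?_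
    exact Subtype.ext (mul_left_cancel₀ hx' (inv_injective h))
  filter_upwards [hc.ae_notMem volume] with z hz
  -- `z = 0` is excluded too, since there `(x * z)⁻¹ = 0⁻¹ = 0` is an integer.
  have hz0 : (x : ℝ) * z ≠ 0 := fun h => hz ⟨0, by simp [h]⟩
  have hcont : Tendsto (fun y : unitInterval => (y : ℝ) * z) (𝓝 x) (𝓝 ((x : ℝ) * z)) :=
    (Continuous.tendsto (by fun_prop) x)
  have hfr : ContinuousAt (Int.fract : ℝ → ℝ) ((x : ℝ) * z)⁻¹ := by
    refine continuousAt_fract ?_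
    intro h
    exact hz ⟨⌊((x : ℝ) * z)⁻¹⌋, h.symm⟩
  have hlim := (hfr.tendsto.comp (hcont.inv₀ hz0)).const_sub (1 / 2 : ℝ)
  have hK : K x z = 1 / 2 - Int.fract ((x : ℝ) * z)⁻¹ := if_neg hz0
  rw [hK]
  refine hlim.congr' ?_
  filter_upwards [hcont.eventually_ne hz0] with y hy
  exact (if_neg hy).symm

/-! ### The kernel sections as vectors of `L²`, and the integral operator -/

theorem inner_toLp {f g : unitInterval → ℝ} (hf : MemLp f 2 volume) (hg : MemLp g 2 volume) :
    inner ℝ (hf.toLp f) (hg.toLp g) = ∫ x, f x * g x := by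
  rw [L2.inner_def]
  refine integral_congr_ae ?_
  filter_upwards [hf.coeFn_toLp, hg.coeFn_toLp] with x h1 h2
  rw [h1, h2]
  exact mul_comm _ _

theorem norm_le_of_ae_abs_le {f : Lp ℝ 2 (volume : Measure unitInterval)} {C : ℝ} (hC : 0 ≤ C)
    (hf : ∀ᵐ x, |f x| ≤ C) : ‖f‖ ≤ C := by
  simpa [measureUnivNNReal] using Lp.norm_le_of_ae_bound (f := f) hC hf

/-- The section `K(x,·)` as a vector of the Hilbert space `L²([0,1])`. -/
def kernelVec (x : unitInterval) : Lp ℝ 2 (volume : Measure unitInterval) :=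
  (memLp_K x).toLp (K x)

theorem inner_kernelVec (x : unitInterval) (f : Lp ℝ 2 (volume : Measure unitInterval)) :
    inner ℝ (kernelVec x) f = ∫ y, K x y * f y := by
  conv_lhs => rw [← Lp.toLp_coeFn f (Lp.memLp f)]
  exact inner_toLp _ _

theorem inner_kernelVec_kernelVec (x y : unitInterval) :
    inner ℝ (kernelVec x) (kernelVec y) = K₂ x y := by
  simp only [kernelVec, inner_toLp, K₂, K_comm y]

theorem kernelVec_zero : kernelVec 0 = 0 := by
  rw [← inner_self_eq_zero (𝕜 := ℝ), inner_kernelVec_kernelVec]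
  simp [K₂, K]

theorem norm_kernelVec_le (x : unitInterval) : ‖kernelVec x‖ ≤ 1 / 2 := by
  refine norm_le_of_ae_abs_le (by norm_num) ((memLp_K x).coeFn_toLp.mono fun y hy => ?_)
  rw [kernelVec, hy]
  exact abs_K_le x y

/-- The sections depend continuously on `x ≠ 0` in the norm of `L²`, by dominated convergence.
At `x = 0` continuity fails. -/
theorem continuousOn_kernelVec : ContinuousOn kernelVec {0}ᶜ := by
  refine continuousOn_of_forall_continuousAt fun x hx => ?_
  rw [ContinuousAt, tendsto_iff_norm_sub_tendsto_zero]
  have hsq (y : unitInterval) : ‖kernelVec y - kernelVec x‖ ^ 2 = ∫ z, (K y z - K x z) ^ 2 := by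
    rw [← real_inner_self_eq_norm_sq, kernelVec, kernelVec, ← MemLp.toLp_sub, inner_toLp]
    simp only [pow_two, Pi.sub_apply]
  have hlim : Tendsto (fun y => ∫ z, (K y z - K x z) ^ 2) (𝓝 x) (𝓝 (∫ _ : unitInterval, 0)) := by
    refine tendsto_integral_filter_of_dominated_convergence (fun _ => 1)
      (Eventually.of_forall fun y =>
        (((measurable_K y).sub (measurable_K x)).pow_const 2).aestronglyMeasurable)
      (Eventually.of_forall fun y => ae_of_all _ fun z => ?_) (integrable_const _) ?_
    · have h1 := abs_le.1 (abs_K_le y z)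
      have h2 := abs_le.1 (abs_K_le x z)
      rw [Real.norm_eq_abs, abs_of_nonneg (sq_nonneg _), sq_le_one_iff_abs_le_one, abs_le]
      constructor <;> linarith
    · filter_upwards [ae_tendsto_K hx] with z hz
      simpa using (hz.sub_const (K x z)).pow 2
  rw [integral_zero] at hlim
  have := hlim.sqrt
  simpa only [← hsq, Real.sqrt_sq (norm_nonneg _), Real.sqrt_zero] using this

theorem measurable_comp_kernelVec {F : Lp ℝ 2 (volume : Measure unitInterval) → ℝ}
    (hF : Continuous F) : Measurable fun x => F (kernelVec x) :=
  measurable_of_continuousOn_compl_singleton 0 (hF.comp_continuousOn continuousOn_kernelVec)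

theorem memLp_inner_kernelVec (f : Lp ℝ 2 (volume : Measure unitInterval)) :
    MemLp (fun x => inner ℝ (kernelVec x) f) 2 volume := by
  refine MemLp.of_bound (measurable_comp_kernelVec (F := fun v => inner ℝ v f)
    (by fun_prop)).aestronglyMeasurable (1 / 2 * ‖f‖)
    (ae_of_all _ fun x => (norm_inner_le_norm _ _).trans ?_)
  gcongr
  exact norm_kernelVec_le x

/-- The integral operator with kernel `K` on `L²([0,1])`. -/
def kernelOp : Lp ℝ 2 (volume : Measure unitInterval) →L[ℝ]
    Lp ℝ 2 (volume : Measure unitInterval) :=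
  LinearMap.mkContinuous
    { toFun := fun f => (memLp_inner_kernelVec f).toLp _
      map_add' := fun f g => by
        rw [← MemLp.toLp_add]
        simp only [inner_add_right]
        rfl
      map_smul' := fun c f => by
        simp only [inner_smul_right, RingHom.id_apply, ← MemLp.toLp_const_smul]
        rfl }
    (1 / 2) fun f => by
      refine norm_le_of_ae_abs_le (by positivity)
        ((memLp_inner_kernelVec f).coeFn_toLp.mono fun x hx => ?_)
      refine (congrArg abs hx).trans_le ((abs_real_inner_le_norm _ _).trans ?_)
      gcongr
      exact norm_kernelVec_le x

theorem kernelOp_apply (f : Lp ℝ 2 (volume : Measure unitInterval)) :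
    kernelOp f = (memLp_inner_kernelVec f).toLp _ := rfl

theorem isSymmetric_kernelOp : kernelOp.IsSymmetric := by
  intro f g
  have hint : Integrable (Function.uncurry fun x y : unitInterval => K x y * f y * g x)
      (volume.prod volume) := by
    have hf : Integrable (f : unitInterval → ℝ) volume := (Lp.memLp f).integrable (by norm_num)
    have hg : Integrable (g : unitInterval → ℝ) volume := (Lp.memLp g).integrable (by norm_num)
    refine ((hg.mul_prod hf).bdd_mul (c := 1 / 2) measurable_uncurry_K.aestronglyMeasurable
      (ae_of_all _ fun p => abs_K_le p.1 p.2)).congr (ae_of_all _ fun p => ?_)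
    simp only [Function.uncurry]
    ring
  change inner ℝ (kernelOp f) g = inner ℝ f (kernelOp g)
  have h1 : inner ℝ (kernelOp f) g = ∫ x, ∫ y, K x y * f y * g x := by
    conv_lhs => rw [kernelOp_apply, ← Lp.toLp_coeFn g (Lp.memLp g), inner_toLp]
    simp only [inner_kernelVec, integral_mul_const]
  have h2 : inner ℝ f (kernelOp g) = ∫ y, ∫ x, K x y * f y * g x := by
    conv_lhs => rw [kernelOp_apply, ← Lp.toLp_coeFn f (Lp.memLp f), inner_toLp]
    simp only [inner_kernelVec, ← integral_const_mul]
    congr 1 with y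
    congr 1 with x
    rw [K_comm y x]
    ring
  rw [h1, h2]
  exact integral_integral_swap hint

/-- If `P` is a symmetric bounded operator, the Hilbert–Schmidt norm of `kernelOp ∘ (1 - P)`, here
computed as the `L²` norm of `x ↦ (1 - P) K(x,·)`, bounds its operator norm. -/
theorem norm_kernelOp_sub_comp_le {P : Lp ℝ 2 (volume : Measure unitInterval) →L[ℝ]
      Lp ℝ 2 (volume : Measure unitInterval)} (hP : P.IsSymmetric) :
    ‖kernelOp ∘L P - kernelOp‖ ≤ √(∫ x, ‖P (kernelVec x) - kernelVec x‖ ^ 2) := by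
  refine ContinuousLinearMap.opNorm_le_bound _ (Real.sqrt_nonneg _) fun f => ?_
  have hsq : ‖kernelOp (P f - f)‖ ^ 2 =
      ∫ x, inner ℝ (P (kernelVec x) - kernelVec x) f ^ 2 := by
    rw [← real_inner_self_eq_norm_sq, kernelOp_apply, inner_toLp]
    congr 1 with x
    rw [inner_sub_right, inner_sub_left,
      show inner ℝ (P (kernelVec x)) f = inner ℝ (kernelVec x) (P f) from hP _ _, pow_two]
  have hle : ‖kernelOp (P f - f)‖ ^ 2 ≤
      (∫ x, ‖P (kernelVec x) - kernelVec x‖ ^ 2) * ‖f‖ ^ 2 := by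
    rw [hsq, ← integral_mul_const]
    have hb (x : unitInterval) : ‖P (kernelVec x) - kernelVec x‖ ≤ (‖P‖ + 1) * (1 / 2) := by
      calc _ ≤ ‖P‖ * ‖kernelVec x‖ + ‖kernelVec x‖ :=
            (norm_sub_le _ _).trans (by gcongr; exact P.le_opNorm _)
        _ = (‖P‖ + 1) * ‖kernelVec x‖ := by ring
        _ ≤ _ := by gcongr; exact norm_kernelVec_le x
    have hi (x : unitInterval) : inner ℝ (P (kernelVec x) - kernelVec x) f ^ 2 ≤
        ‖P (kernelVec x) - kernelVec x‖ ^ 2 * ‖f‖ ^ 2 := by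
      rw [← mul_pow, ← sq_abs]
      gcongr
      exact abs_real_inner_le_norm _ _
    have hint : Integrable (fun x => ‖P (kernelVec x) - kernelVec x‖ ^ 2 * ‖f‖ ^ 2) volume := by
      refine Integrable.of_bound (measurable_comp_kernelVec
        (F := fun v => ‖P v - v‖ ^ 2 * ‖f‖ ^ 2) (by fun_prop)).aestronglyMeasurable
        (((‖P‖ + 1) * (1 / 2)) ^ 2 * ‖f‖ ^ 2) (ae_of_all _ fun x => ?_)
      rw [Real.norm_of_nonneg (by positivity)]
      gcongr
      exact hb x
    refine integral_mono_of_nonneg (ae_of_all _ fun x => sq_nonneg _) hint (ae_of_all _ hi)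
  calc ‖(kernelOp ∘L P - kernelOp) f‖ = ‖kernelOp (P f - f)‖ := by simp
    _ = √(‖kernelOp (P f - f)‖ ^ 2) := (Real.sqrt_sq (norm_nonneg _)).symm
    _ ≤ √((∫ x, ‖P (kernelVec x) - kernelVec x‖ ^ 2) * ‖f‖ ^ 2) := Real.sqrt_le_sqrt hle
    _ = _ := by rw [Real.sqrt_mul' _ (sq_nonneg _), Real.sqrt_sq (norm_nonneg _)]

/-- The integral operator is the limit in norm of its compositions with the projections onto an
exhausting sequence of finite-dimensional subspaces. -/
theorem isCompactOperator_kernelOp : IsCompactOperator kernelOp := by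
  have : Fact ((2 : ENNReal) ≠ ⊤) := ⟨by norm_num⟩
  let u : ℕ → Lp ℝ 2 (volume : Measure unitInterval) := TopologicalSpace.denseSeq _
  let U : ℕ → Submodule ℝ (Lp ℝ 2 (volume : Measure unitInterval)) := fun n =>
    Submodule.span ℝ (u '' Set.Iio n)
  have hfin (n : ℕ) : FiniteDimensional ℝ (U n) :=
    FiniteDimensional.span_of_finite ℝ ((Set.finite_Iio n).image u)
  have hmono : Monotone U := fun m n hmn =>
    Submodule.span_mono (Set.image_mono (Set.Iio_subset_Iio hmn))
  have hdense : ⊤ ≤ (⨆ n, U n).topologicalClosure := by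
    intro v _
    have hsub : Set.range u ⊆ (⨆ n, U n : Submodule ℝ _) := by
      rintro _ ⟨n, rfl⟩
      exact Submodule.mem_iSup_of_mem (n + 1)
        (Submodule.subset_span ⟨n, Nat.lt_succ_self n, rfl⟩)
    exact closure_mono hsub (TopologicalSpace.denseRange_denseSeq _ v)
  have hproj (n : ℕ) (v : Lp ℝ 2 (volume : Measure unitInterval)) :
      ‖(U n).starProjection v - v‖ ≤ 2 * ‖v‖ := by
    calc _ ≤ ‖(U n).starProjection v‖ + ‖v‖ := norm_sub_le _ _
      _ ≤ ‖v‖ + ‖v‖ := by gcongr; exact Submodule.norm_starProjection_apply_le _ v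
      _ = 2 * ‖v‖ := (two_mul _).symm
  have hlim : Tendsto (fun n => ∫ x, ‖(U n).starProjection (kernelVec x) - kernelVec x‖ ^ 2) atTop
      (𝓝 (∫ _ : unitInterval, 0)) := by
    refine tendsto_integral_of_dominated_convergence (fun _ => 1) (fun n =>
      (measurable_comp_kernelVec (F := fun v => ‖(U n).starProjection v - v‖ ^ 2)
        (by fun_prop)).aestronglyMeasurable) (integrable_const _)
      (fun n => ae_of_all _ fun x => ?_) (ae_of_all _ fun x => ?_)
    · rw [Real.norm_of_nonneg (by positivity)]
      refine pow_le_one₀ (norm_nonneg _) ((hproj n _).trans ?_)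
      linarith [norm_kernelVec_le x]
    · simpa using (tendsto_iff_norm_sub_tendsto_zero.1
        (Submodule.starProjection_tendsto_self U hmono (kernelVec x) hdense)).pow 2
  rw [integral_zero] at hlim
  refine isCompactOperator_of_tendsto (F := fun n => kernelOp ∘L (U n).starProjection) (l := atTop)
    ?_ (Eventually.of_forall fun n => ?_)
  · rw [tendsto_iff_norm_sub_tendsto_zero]
    refine squeeze_zero (fun _ => norm_nonneg _) (fun n => norm_kernelOp_sub_comp_le
      (Submodule.starProjection_isSymmetric _)) ?_
    simpa using hlim.sqrt
  · exact (isCompactOperator_of_locallyCompactSpace_dom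
      (U n).orthogonalProjectionOnto).clm_comp (kernelOp ∘L (U n).subtypeL)

/-! ### Expansion in eigenfunctions -/

theorem IsEigenfunction.eq_mul_inner {μ : ℝ} {ψ : unitInterval → ℝ} (h : IsEigenfunction μ ψ)
    (x : unitInterval) : ψ x = μ * inner ℝ (kernelVec x) (h.memLp.toLp ψ) := by
  rw [kernelVec, inner_toLp]
  exact h.eq_integral x

/-- An eigenvector of the integral operator has a representative which satisfies the eigenfunction
equation at every point: its image under the integral is defined pointwise. -/
theorem exists_isEigenfunction {α : ℝ} (hα : α ≠ 0) {v : Lp ℝ 2 (volume : Measure unitInterval)}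
    (hv : v ≠ 0) (hTv : kernelOp v = α • v) :
    ∃ ψ : unitInterval → ℝ, IsEigenfunction α⁻¹ ψ ∧ ψ =ᵐ[volume] v := by
  have hae : (fun x => α⁻¹ * inner ℝ (kernelVec x) v) =ᵐ[volume] v := by
    have h1 := (memLp_inner_kernelVec v).coeFn_toLp
    rw [← kernelOp_apply, hTv] at h1
    filter_upwards [h1, Lp.coeFn_smul α v] with x hx1 hx2
    rw [← hx1, hx2, Pi.smul_apply, smul_eq_mul, inv_mul_cancel_left₀ hα]
  refine ⟨_, ⟨(memLp_congr_ae hae).2 (Lp.memLp v), ?_, fun x => ?_⟩, hae⟩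
  · have : innerL2 (fun x => α⁻¹ * inner ℝ (kernelVec x) v)
        (fun x => α⁻¹ * inner ℝ (kernelVec x) v) = inner ℝ v v := by
      rw [L2.inner_def]
      exact integral_congr_ae (hae.mono fun x hx => by simp [hx, pow_two])
    rw [this]
    exact real_inner_self_pos.2 hv
  · rw [inner_kernelVec]
    congr 1
    exact integral_congr_ae (hae.mono fun y hy => by simp only [hy])

instance isOpenPosMeasure_volume : (volume : Measure unitInterval).IsOpenPosMeasure where
  open_pos := by
    rintro _ ⟨V, hV, rfl⟩ ⟨x, hx⟩ h0
    have hxc : (x : ℝ) ∈ closure (Set.Ioo (0 : ℝ) 1) := by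
      rw [closure_Ioo zero_ne_one]
      exact x.2
    refine (hV.inter isOpen_Ioo).measure_ne_zero volume (mem_closure_iff.1 hxc V hV hx)
      (measure_mono_null ?_ (unitInterval.volume_apply.symm.trans h0))
    exact fun y hy => ⟨⟨y, Set.Ioo_subset_Icc_self hy.2⟩, hy.1, rfl⟩

/-- A vector killed by the integral operator is orthogonal to every section `K(x,·)`, not just to
almost every one, since the sections depend continuously on `x ≠ 0` and `K(0,·) = 0`. -/
theorem inner_kernelVec_eq_zero {g : Lp ℝ 2 (volume : Measure unitInterval)}
    (hg : kernelOp g = 0) (x : unitInterval) : inner ℝ (kernelVec x) g = 0 := by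
  rcases eq_or_ne x 0 with rfl | hx
  · rw [kernelVec_zero, inner_zero_left]
  have h1 := (memLp_inner_kernelVec g).coeFn_toLp
  rw [← kernelOp_apply, hg] at h1
  have h2 : (fun x => inner ℝ (kernelVec x) g) =ᵐ[volume] fun _ => (0 : ℝ) :=
    h1.symm.trans (Lp.coeFn_zero ℝ 2 volume)
  exact Measure.eqOn_open_of_ae_eq (ae_restrict_of_ae h2) isOpen_compl_singleton
    (continuousOn_kernelVec.inner continuousOn_const) continuousOn_const hx

namespace IsMaximalEigensystem

variable {ev : ℕ → ℝ} {φ : ℕ → unitInterval → ℝ}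

/-- The eigenfunctions of the system as vectors of the Hilbert space `L²([0,1])`. -/
def vec (h : IsMaximalEigensystem ev φ) (j : ℕ) : Lp ℝ 2 (volume : Measure unitInterval) :=
  (h.isEigenfunction j).memLp.toLp (φ j)

theorem orthonormal_vec (h : IsMaximalEigensystem ev φ) : Orthonormal ℝ h.vec := by
  rw [orthonormal_iff_ite]
  intro i j
  rw [vec, vec, inner_toLp]
  exact h.orthonormal i j

/-- The values of the eigenfunctions are, up to the eigenvalue, the Fourier coefficients of the
kernel sections. -/
theorem mul_div_sq_eq (h : IsMaximalEigensystem ev φ) (j : ℕ) (x y : unitInterval) :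
    φ j x * φ j y / ev j ^ 2 =
    inner ℝ (kernelVec x) (h.vec j) * inner ℝ (kernelVec y) (h.vec j) := by
  rw [(h.isEigenfunction j).eq_mul_inner x, (h.isEigenfunction j).eq_mul_inner y, vec]
  have := h.ev_ne_zero j
  field_simp

theorem kernelOp_vec (h : IsMaximalEigensystem ev φ) (j : ℕ) :
    kernelOp (h.vec j) = (ev j)⁻¹ • h.vec j := by
  rw [kernelOp_apply, vec, ← MemLp.toLp_const_smul]
  congr 1
  ext x
  rw [Pi.smul_apply, (h.isEigenfunction j).eq_mul_inner x, smul_eq_mul,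
    inv_mul_cancel_left₀ (h.ev_ne_zero j)]

theorem kernelOp_eq_zero (h : IsMaximalEigensystem ev φ)
    {g : Lp ℝ 2 (volume : Measure unitInterval)} (hg : ∀ j, inner ℝ g (h.vec j) = 0) :
    kernelOp g = 0 := by
  refine apply_eq_zero_of_maximal_eigenvectors isCompactOperator_kernelOp isSymmetric_kernelOp
    h.kernelOp_vec (fun α v hα hv hTv => ?_) hg
  obtain ⟨ψ, hψ, hae⟩ := exists_isEigenfunction hα hv hTv
  obtain ⟨j, hj⟩ := h.maximal _ ψ hψ
  refine ⟨j, ?_⟩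
  have : v = hψ.memLp.toLp ψ := by
    rw [← Lp.toLp_coeFn v (Lp.memLp v)]
    exact (MemLp.toLp_eq_toLp_iff _ _).2 hae.symm
  rw [this, vec, inner_toLp]
  exact hj

/-- Every kernel section lies in the closed span of the eigenfunctions. -/
theorem kernelVec_mem (h : IsMaximalEigensystem ev φ) (x : unitInterval) :
    kernelVec x ∈ (Submodule.span ℝ (Set.range h.vec))ᗮᗮ :=
  (Submodule.mem_orthogonal' _ _).2 fun _ hg =>
    inner_kernelVec_eq_zero (h.kernelOp_eq_zero (mem_orthogonal_span_range.1 hg)) x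

theorem hasSum (h : IsMaximalEigensystem ev φ) (x y : unitInterval) :
    HasSum (fun j => φ j x * φ j y / ev j ^ 2) (K₂ x y) := by
  simp only [h.mul_div_sq_eq, ← inner_kernelVec_kernelVec]
  exact hasSum_inner_mul_inner_of_orthonormal h.orthonormal_vec (h.kernelVec_mem x)
    (h.kernelVec_mem y)

/-- The squared distance of the section `K(x,·)` from the span of the first `n` eigenfunctions. -/
def defect (h : IsMaximalEigensystem ev φ) (n : ℕ) (x : unitInterval) : ℝ :=
  ‖kernelVec x‖ ^ 2 - ∑ j ∈ Finset.range n, inner ℝ (kernelVec x) (h.vec j) ^ 2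

/-- On `[ε,1]` the defects tend to zero uniformly, by Dini's theorem. -/
theorem tendstoUniformlyOn_defect (h : IsMaximalEigensystem ev φ) {ε : ℝ} (hε : 0 < ε) :
    TendstoUniformlyOn h.defect 0 atTop {x : unitInterval | ε ≤ x} := by
  have hne : {x : unitInterval | ε ≤ x} ⊆ {0}ᶜ := by
    rintro x hx rfl
    exact absurd hx (not_le.2 hε)
  have hk : ContinuousOn kernelVec {x : unitInterval | ε ≤ x} := continuousOn_kernelVec.mono hne
  refine Antitone.tendstoUniformlyOn_of_forall_tendsto ?_ (fun n => ?_) (fun x _ m n hmn => ?_)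
    continuousOn_const fun x _ => ?_
  · exact (isClosed_le continuous_const continuous_subtype_val).isCompact
  · exact (hk.norm.pow 2).sub (continuousOn_finsetSum _ fun j _ =>
      (hk.inner continuousOn_const).pow 2)
  · exact sub_le_sub_left (Finset.sum_le_sum_of_subset_of_nonneg
      (Finset.range_mono hmn) fun _ _ _ => sq_nonneg _) _
  · have hs := (hasSum_inner_mul_inner_of_orthonormal h.orthonormal_vec (h.kernelVec_mem x)
      (h.kernelVec_mem x)).tendsto_sum_nat.const_sub (‖kernelVec x‖ ^ 2)
    rw [real_inner_self_eq_norm_sq, sub_self] at hs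
    simpa only [defect, pow_two, Pi.zero_apply] using hs

theorem abs_sub_sum_le (h : IsMaximalEigensystem ev φ) (x y : unitInterval) (n : ℕ) :
    |K₂ x y - ∑ j ∈ Finset.range n, φ j x * φ j y / ev j ^ 2| ≤ √(h.defect n x) := by
  simp only [h.mul_div_sq_eq, ← inner_kernelVec_kernelVec]
  refine (abs_inner_sub_sum_le h.orthonormal_vec _ _ n).trans
    (mul_le_of_le_one_right (Real.sqrt_nonneg _) ?_)
  linarith [norm_kernelVec_le y]

end IsMaximalEigensystem

end FloorKernel

end

theorem theorem2p11 (ev : ℕ → ℝ) (φ : ℕ → unitInterval → ℝ)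
    (h : FloorKernel.IsMaximalEigensystem ev φ) :
    (∀ x y : unitInterval,
      Summable (fun j : ℕ => |φ j x * φ j y / ev j ^ 2|) ∧
      HasSum (fun j : ℕ => φ j x * φ j y / ev j ^ 2) (FloorKernel.K₂ x y)) ∧
    (∀ ε : ℝ, 0 < ε →
      TendstoUniformlyOn
        (fun (N : ℕ) (p : unitInterval × unitInterval) =>
          ∑ j ∈ Finset.range N, φ j p.1 * φ j p.2 / ev j ^ 2)
        (fun p : unitInterval × unitInterval => FloorKernel.K₂ p.1 p.2)
        Filter.atTop
        {p : unitInterval × unitInterval |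
          ¬ ((p.1 : ℝ) ∈ Set.Ioo 0 ε ∧ (p.2 : ℝ) ∈ Set.Ioo 0 ε)}) := by
  refine ⟨fun x y => ⟨(h.hasSum x y).summable.abs, h.hasSum x y⟩, fun ε hε => ?_⟩
  rw [Metric.tendstoUniformlyOn_iff]
  intro δ hδ
  have hdef := Metric.tendstoUniformlyOn_iff.1 (h.tendstoUniformlyOn_defect hε) (δ ^ 2)
    (by positivity)
  filter_upwards [hdef] with n hn
  have hbound (x y : unitInterval) (hx : (x : ℝ) ∉ Set.Ioo 0 ε) :
      |FloorKernel.K₂ x y - ∑ j ∈ Finset.range n, φ j x * φ j y / ev j ^ 2| < δ := by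
    refine (h.abs_sub_sum_le x y n).trans_lt ((Real.sqrt_lt' hδ).2 ?_)
    rcases eq_or_ne x 0 with rfl | hx0
    · simpa [FloorKernel.IsMaximalEigensystem.defect, FloorKernel.kernelVec_zero] using pow_pos hδ 2
    · have hxε : ε ≤ x := not_lt.1 fun hlt => hx ⟨unitInterval.pos_iff_ne_zero.2 hx0, hlt⟩
      have := hn x hxε
      rw [Pi.zero_apply, dist_zero_left, Real.norm_eq_abs] at this
      exact (le_abs_self _).trans_lt this
  rintro ⟨x, y⟩ hxy
  rw [Real.dist_eq]
  rcases not_and_or.1 hxy with hx | hy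
  · exact hbound x y hx
  -- The case of the second variable follows from the symmetry of `K₂` and of the partial sums.
  · have hK : FloorKernel.K₂ x y = FloorKernel.K₂ y x := by
      simp only [← FloorKernel.inner_kernelVec_kernelVec, real_inner_comm]
    simpa only [hK, mul_comm (φ _ x)] using hbound y x hy
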